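/- Let $R$ be a (not necessarily commutative) ring with unit and let $D(R)$ be the unbounded derived category of the category of right $R$-modules, with shift $[1]$. For $X\in D(R)$ and a set $I\subseteq\mathbb Z$ put $$X^{\perp_I}=\{Y\in D(R)\mid \operatorname{Hom}_{D(R)}(X,Y[i])=0\ \text{for all } i\in I\},\qquad {}^{\perp_I}X=\{Y\in D(R)\mid \operatorname{Hom}_{D(R)}(Y,X[i])=0\ \text{for all } i\in I\},$$ and write $>0$, $\le 0$ for the corresponding sets of integers. Let $\mathrm{Add}(X)$ (resp. $\mathrm{Prod}(X)$) be the class of all direct summands of arbitrary set-indexed coproducts (resp. products) of copies of $X$ in $D(R)$. A t-structure in $D(R)$ is a pair $(\mathcal U,\mathcal V)$ of full subcategories closed under direct summands such that $\mathcal V$ consists exactly of the objects $V$ with $\operatorname{Hom}(U,V)=0$ for all $U\in\mathcal U$, $\mathcal U$ consists exactly of the objects $U$ with $\operatorname{Hom}(U,V)=0$ for all $V\in\mathcal V$, every $X\in D(R)$ lies in a triangle $U\to X\to V\to U[1]$ with $U\in\mathcal U$ and $V\in\mathcal V$, and $\mathcal U[1]\subseteq\mathcal U$. An object $T\in D(R)$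 is called silting if $(T^{\perp_{>0}},T^{\perp_{\le 0}})$ is a t-structure, and $C\in D(R)$ is called cosilting if $({}^{\perp_{\le 0}}C,{}^{\perp_{>0}}C)$ is a t-structure. **Theorem.** 1. Let $T\in D(R)$ be isomorphic in $D(R)$ to a bounded complex of projective right $R$-modules. Then $T$ is silting if and only if $\mathrm{Add}(T)\subseteq T^{\perp_{>0}}$ and $T$ generates $D(R)$, that is, $T^{\perp_{\mathbb Z}}=\{0\}$. 2. Let $C\in D(R)$ be isomorphic in $D(R)$ to a bounded complex of injective right $R$-modules. Then $C$ is cosilting if and only if $\mathrm{Prod}(C)\subseteq{}^{\perp_{>0}}C$ and $C$ cogenerates $D(R)$, that is, ${}^{\perp_{\mathbb Z}}C=\{0\}$. -/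

import Mathlib

open CategoryTheory Limits Pretriangulated

universe t w v u

namespace Silting

section Category

variable {D : Type u} [Category.{v} D]

/-- `Add(𝒞)`: all direct summands of all (set-indexed) coproducts of objects of `𝒞`.
The index sets of the coproducts live in `Type t`. -/
def addClosure (P : ObjectProperty D) : ObjectProperty D := fun X =>
  ∃ (I : Type t) (F : I → D) (c : Cofan F),
    (∀ i, P (F i)) ∧ Nonempty (IsColimit c) ∧ Nonempty (Retract X c.pt)

/-- `Prod(𝒞)`: all direct summands of all (set-indexed) products of objects of `𝒞`.
The index sets of the products live in `Type t`. -/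
def prodClosure (P : ObjectProperty D) : ObjectProperty D := fun X =>
  ∃ (I : Type t) (F : I → D) (c : Fan F),
    (∀ i, P (F i)) ∧ Nonempty (IsLimit c) ∧ Nonempty (Retract X c.pt)

end Category

section Triangulated

variable {D : Type u} [Category.{v} D] [Preadditive D] [HasShift D ℤ]

/-- `𝒞^{⊥_I} = {X | Hom(C, X[i]) = 0 for all C ∈ 𝒞 and all i ∈ I}`. -/
def rightPerp (P : ObjectProperty D) (I : Set ℤ) : ObjectProperty D := fun X =>
  ∀ C : D, P C → ∀ i ∈ I, ∀ f : C ⟶ X⟦i⟧, f = 0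

/-- `^{⊥_I}𝒞 = {X | Hom(X, C[i]) = 0 for all C ∈ 𝒞 and all i ∈ I}`. -/
def leftPerp (P : ObjectProperty D) (I : Set ℤ) : ObjectProperty D := fun X =>
  ∀ C : D, P C → ∀ i ∈ I, ∀ f : X ⟶ C⟦i⟧, f = 0

variable [HasZeroObject D] [∀ n : ℤ, (shiftFunctor D n).Additive] [Pretriangulated D]

/-- A torsion pair `(𝒰, 𝒱)` in a triangulated category. -/
structure IsTorsionPair (U V : ObjectProperty D) : Prop where
  left_retracts : U.IsStableUnderRetracts
  right_retracts : V.IsStableUnderRetracts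
  right_eq : U.rightOrthogonal = V
  left_eq : V.leftOrthogonal = U
  exists_triangle : ∀ X : D, ∃ (A B : D) (f : A ⟶ X) (g : X ⟶ B) (h : B ⟶ A⟦(1 : ℤ)⟧),
    U A ∧ V B ∧ Triangle.mk f g h ∈ distTriang D

/-- A t-structure, given by its aisle `𝒰` and coaisle `𝒱`: a torsion pair `(𝒰, 𝒱)` with
`𝒰[1] ⊆ 𝒰`. -/
structure IsTStructure (U V : ObjectProperty D) : Prop extends IsTorsionPair U V where
  shift_mem : ∀ X : D, U X → U (X⟦(1 : ℤ)⟧)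

/-- `T` is silting if `(T^{⊥_{>0}}, T^{⊥_{≤0}})` is a t-structure. -/
def IsSilting (T : D) : Prop :=
  IsTStructure (rightPerp (ObjectProperty.singleton T) (Set.Ioi 0))
    (rightPerp (ObjectProperty.singleton T) (Set.Iic 0))

/-- `C` is cosilting if `(^{⊥_{≤0}}C, ^{⊥_{>0}}C)` is a t-structure. -/
def IsCosilting (C : D) : Prop :=
  IsTStructure (leftPerp (ObjectProperty.singleton C) (Set.Iic 0))
    (leftPerp (ObjectProperty.singleton C) (Set.Ioi 0))

end Triangulated

section Derived

variable {A : Type u} [Category.{v} A] [Abelian A] [HasDerivedCategory.{t} A]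

/-- `T` is isomorphic in the derived category to a bounded complex of projective objects. -/
def IsBoundedProjective (T : DerivedCategory A) : Prop :=
  ∃ (K : CochainComplex A ℤ) (a b : ℤ), K.IsStrictlyGE a ∧ K.IsStrictlyLE b ∧
    (∀ i, Projective (K.X i)) ∧ Nonempty (T ≅ DerivedCategory.Q.obj K)

/-- `C` is isomorphic in the derived category to a bounded complex of injective objects. -/
def IsBoundedInjective (C : DerivedCategory A) : Prop :=
  ∃ (K : CochainComplex A ℤ) (a b : ℤ), K.IsStrictlyGE a ∧ K.IsStrictlyLE b ∧
    (∀ i, Injective (K.X i)) ∧ Nonempty (C ≅ DerivedCategory.Q.obj K)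

end Derived

end Silting

/-! If the pair is a t-structure, the two conditions are formal. `T` is left orthogonal to the
coaisle, hence so is every summand of a coproduct of copies of `T`, and the aisle is that whole left
orthogonal. An object orthogonal to all shifts of `T` lies in both aisle and coaisle, so its
identity vanishes. Boundedness plays no role here.

For the converse let `T` be a bounded complex `K` of projectives. Given a complex `X`, form a tower
`X = B₀ → B₁ → ⋯` in which `Bₙ₊₁` is the cone of a map from a coproduct of copies of `K⟦n⟧` to `Bₙ`,
one copy for each chain map. Each step kills `Hom(K⟦n⟧, -)`. The hypothesis on `Add(T)` gives
`Hom(K⟦j⟧, ∐ K⟦n⟧) = 0` for `j < n`, so a step restores nothing killed earlier and keeps control of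
`Hom(K⟦j⟧, -)` for `j ≤ 0` (`isSiltingStep_inr`).

The limit of the tower is the ordinary colimit `B` of complexes. Since `K` is bounded above, the
tower is stationary in each fixed degree. Since `K` is also bounded below, maps from a fixed `K⟦j⟧`
into `B` agree with maps into a late stage (`bijective_postcomp_of_isIso_f`). This takes the place
of compactness of `T`, and no exactness of filtered colimits is used.

Thus `B` lies in the coaisle, the cocone of `X → B` lies in the aisle, and every map from `X` to the
coaisle factors through `B` (`exists_silting_approximation`). If `X` is in the aisle, then `B` is
orthogonal to every shift of `T`, hence zero because `T` generates; so aisle and coaisle are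
orthogonal (`isSilting_of_exists`).

The cosilting case is dual: products, cocones and a limit over `ℕᵒᵖ`, with bounded complexes of
injectives. -/

namespace Silting

/-! ### Vanishing, injectivity and surjectivity on Hom groups. -/

section HomZero

variable {D : Type u} [Category.{v} D] [Preadditive D]

/-- All morphisms from `A` to `X` are zero. -/
def HomZero (A X : D) : Prop := ∀ f : A ⟶ X, f = 0

lemma HomZero.of_iso {A A' X X' : D} (h : HomZero A X) (e : A ≅ A') (e' : X ≅ X') :
    HomZero A' X' := fun f => by
  have := h (e.hom ≫ f ≫ e'.inv)
  rwa [← cancel_epi e.hom, ← cancel_mono e'.inv, Category.assoc, comp_zero, zero_comp]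

lemma homZero_map_iff {E : Type*} [Category E] [Preadditive E] (F : D ⥤ E) [F.Full] [F.Faithful]
    [F.PreservesZeroMorphisms] {A X : D} : HomZero (F.obj A) (F.obj X) ↔ HomZero A X := by
  constructor
  · intro h f
    exact F.map_injective (by rw [h (F.map f), F.map_zero])
  · intro h f
    obtain ⟨g, rfl⟩ := F.map_surjective f
    rw [h g, F.map_zero]

lemma HomZero.of_retract_right {A X Y : D} (h : HomZero A Y) (r : Retract X Y) : HomZero A X :=
  fun f => by rw [← Category.comp_id f, ← r.retract, ← Category.assoc, h (f ≫ r.i), zero_comp]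

lemma HomZero.of_retract_left {A X Y : D} (h : HomZero Y A) (r : Retract X Y) : HomZero X A :=
  fun f => by rw [← Category.id_comp f, ← r.retract, Category.assoc, h (r.r ≫ f), comp_zero]

lemma HomZero.isZero {X : D} (h : HomZero X X) : IsZero X :=
  (IsZero.iff_id_eq_zero X).2 (h _)

/-- Postcomposition with `f` is injective on morphisms from `A`. -/
def PostcompInj (A : D) {X Y : D} (f : X ⟶ Y) : Prop := ∀ x : A ⟶ X, x ≫ f = 0 → x = 0

/-- Postcomposition with `f` is surjective on morphisms from `A`. -/
def PostcompSurj (A : D) {X Y : D} (f : X ⟶ Y) : Prop := ∀ y : A ⟶ Y, ∃ x : A ⟶ X, x ≫ f = y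

/-- Precomposition with `f` is injective on morphisms to `A`. -/
def PrecompInj (A : D) {X Y : D} (f : X ⟶ Y) : Prop := ∀ x : Y ⟶ A, f ≫ x = 0 → x = 0

/-- Precomposition with `f` is surjective on morphisms to `A`. -/
def PrecompSurj (A : D) {X Y : D} (f : X ⟶ Y) : Prop := ∀ y : X ⟶ A, ∃ x : Y ⟶ A, f ≫ x = y

variable {A X Y Z : D} {f : X ⟶ Y} {g : Y ⟶ Z}

lemma PostcompInj.comp (hf : PostcompInj A f) (hg : PostcompInj A g) : PostcompInj A (f ≫ g) :=
  fun x hx => hf x (hg _ (by rwa [Category.assoc]))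

omit [Preadditive D] in
lemma PostcompSurj.comp (hf : PostcompSurj A f) (hg : PostcompSurj A g) :
    PostcompSurj A (f ≫ g) := fun y => by
  obtain ⟨y', rfl⟩ := hg y
  obtain ⟨x, rfl⟩ := hf y'
  exact ⟨x, by rw [Category.assoc]⟩

lemma PrecompInj.comp (hf : PrecompInj A f) (hg : PrecompInj A g) : PrecompInj A (f ≫ g) :=
  fun x hx => hg x (hf _ (by rwa [← Category.assoc]))

omit [Preadditive D] in
lemma PrecompSurj.comp (hf : PrecompSurj A f) (hg : PrecompSurj A g) :
    PrecompSurj A (f ≫ g) := fun y => by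
  obtain ⟨y', rfl⟩ := hf y
  obtain ⟨x, rfl⟩ := hg y'
  exact ⟨x, by rw [Category.assoc]⟩

lemma postcompInj_of_isIso (A : D) (f : X ⟶ Y) [IsIso f] : PostcompInj A f := fun x hx => by
  rwa [← cancel_mono f, zero_comp]

omit [Preadditive D] in
lemma postcompSurj_of_isIso (A : D) (f : X ⟶ Y) [IsIso f] : PostcompSurj A f :=
  fun y => ⟨y ≫ inv f, by simp⟩

lemma precompInj_of_isIso (A : D) (f : X ⟶ Y) [IsIso f] : PrecompInj A f := fun x hx => by
  rwa [← cancel_epi f, comp_zero]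

omit [Preadditive D] in
lemma precompSurj_of_isIso (A : D) (f : X ⟶ Y) [IsIso f] : PrecompSurj A f :=
  fun y => ⟨inv f ≫ y, by simp⟩

omit [Preadditive D] in
lemma PostcompSurj.of_iso {A' : D} (h : PostcompSurj A f) (e : A ≅ A') : PostcompSurj A' f :=
  fun y => by
    obtain ⟨x, hx⟩ := h (e.hom ≫ y)
    exact ⟨e.inv ≫ x, by simp [hx]⟩

lemma PrecompInj.of_iso {A' : D} (h : PrecompInj A f) (e : A ≅ A') : PrecompInj A' f :=
  fun x hx => by
    have := h (x ≫ e.inv) (by rw [← Category.assoc, hx, zero_comp])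
    rwa [← cancel_mono e.inv, zero_comp]

lemma HomZero.of_postcompSurj (h : HomZero A X) (hf : PostcompSurj A f) : HomZero A Y := by
  intro y
  obtain ⟨x, rfl⟩ := hf y
  rw [h x, zero_comp]

lemma HomZero.of_precompSurj (h : HomZero Y A) (hf : PrecompSurj A f) : HomZero X A := by
  intro y
  obtain ⟨x, rfl⟩ := hf y
  rw [h x, comp_zero]

end HomZero

/-! ### Long exact Hom sequences, and formal criteria for silting and cosilting objects. -/

section Triangulated

variable {D : Type u} [Category.{v} D] [Preadditive D] [HasShift D ℤ]
  [∀ n : ℤ, (shiftFunctor D n).Additive]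

lemma homZero_shift_iff {A X : D} (n : ℤ) : HomZero (A⟦n⟧) (X⟦n⟧) ↔ HomZero A X :=
  homZero_map_iff (shiftFunctor D n)

lemma homZero_shift_add_left_iff {A X : D} (i j k : ℤ) (h : i = j + k) :
    HomZero (A⟦i⟧) (X⟦k⟧) ↔ HomZero (A⟦j⟧) X := by
  rw [← homZero_shift_iff (A := A⟦j⟧) k]
  have e := (shiftFunctorAdd' D j k i h.symm).app A
  exact ⟨fun h => h.of_iso e (Iso.refl _), fun h => h.of_iso e.symm (Iso.refl _)⟩

lemma homZero_shift_add_right_iff {A X : D} (i j k : ℤ) (h : i = j + k) :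
    HomZero (X⟦k⟧) (A⟦i⟧) ↔ HomZero X (A⟦j⟧) := by
  rw [← homZero_shift_iff (X := A⟦j⟧) k]
  have e := (shiftFunctorAdd' D j k i h.symm).app A
  exact ⟨fun h => h.of_iso (Iso.refl _) e, fun h => h.of_iso (Iso.refl _) e.symm⟩

lemma homZero_shift_left_iff {A X : D} (n m : ℤ) (h : n + m = 0) :
    HomZero (A⟦n⟧) X ↔ HomZero A (X⟦m⟧) := by
  rw [← homZero_shift_add_left_iff 0 n m h.symm]
  have e := (shiftFunctorZero D ℤ).app A
  exact ⟨fun h => h.of_iso e (Iso.refl _), fun h => h.of_iso e.symm (Iso.refl _)⟩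

lemma rightPerp_singleton_iff (T X : D) (I : Set ℤ) :
    rightPerp (ObjectProperty.singleton T) I X ↔ ∀ i, -i ∈ I → HomZero (T⟦i⟧) X := by
  constructor
  · intro h i hi
    rw [homZero_shift_left_iff i (-i) (by lia)]
    exact h T (by simp) _ hi
  · intro h C hC i hi
    obtain rfl := ((ObjectProperty.singleton_iff _ _).1 hC)
    exact (homZero_shift_left_iff (-i) i (by lia)).1 (h (-i) (by simpa))

omit [∀ n : ℤ, (shiftFunctor D n).Additive] in
lemma leftPerp_singleton_iff (T X : D) (I : Set ℤ) :
    leftPerp (ObjectProperty.singleton T) I X ↔ ∀ i ∈ I, HomZero X (T⟦i⟧) := by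
  constructor
  · exact fun h i hi => h T (by simp) _ hi
  · intro h C hC i hi
    obtain rfl := ((ObjectProperty.singleton_iff _ _).1 hC)
    exact h i hi

variable [HasZeroObject D] [Pretriangulated D]

section

variable {t : Triangle D} (ht : t ∈ distTriang D) {A : D}
include ht

lemma postcompSurj_mor₂ (h : HomZero A (t.obj₁⟦(1 : ℤ)⟧)) : PostcompSurj A t.mor₂ := fun y =>
  (Triangle.coyoneda_exact₃ t ht y (h _)).imp fun _ h => h.symm

lemma postcompInj_mor₂ (h : HomZero A t.obj₁) : PostcompInj A t.mor₂ := fun x hx => by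
  obtain ⟨y, rfl⟩ := Triangle.coyoneda_exact₂ t ht x hx
  rw [h y, zero_comp]

lemma postcompSurj_mor₁ (h : HomZero A t.obj₃) : PostcompSurj A t.mor₁ := fun y =>
  (Triangle.coyoneda_exact₂ t ht y (h _)).imp fun _ h => h.symm

lemma postcompInj_mor₁ (h : HomZero (A⟦(1 : ℤ)⟧) t.obj₃) : PostcompInj A t.mor₁ := fun x hx => by
  refine (shiftFunctor D (1 : ℤ)).map_injective ?_
  obtain ⟨y, hy⟩ := Triangle.coyoneda_exact₁ t ht (x⟦(1 : ℤ)⟧')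
    (by rw [← Functor.map_comp, hx, Functor.map_zero])
  rw [hy, h y, zero_comp, Functor.map_zero]

/-- In the long exact sequence, `Hom(A, t.obj₁)` sits between a surjection one degree earlier and an
injection. This puts the cocone of an approximation in the aisle. -/
lemma homZero_obj₁ (h₁ : PostcompSurj (A⟦(1 : ℤ)⟧) t.mor₂) (h₂ : PostcompInj A t.mor₂) :
    HomZero A t.obj₁ := by
  intro x
  have hx : x ≫ t.mor₁ = 0 := h₂ _ (by
    rw [Category.assoc, comp_distTriang_mor_zero₁₂ _ ht, comp_zero])
  refine (shiftFunctor D (1 : ℤ)).map_injective ?_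
  obtain ⟨y, hy⟩ := Triangle.coyoneda_exact₁ t ht (x⟦(1 : ℤ)⟧')
    (by rw [← Functor.map_comp, hx, Functor.map_zero])
  obtain ⟨z, rfl⟩ := h₁ y
  rw [hy, Category.assoc, comp_distTriang_mor_zero₂₃ _ ht, comp_zero, Functor.map_zero]

lemma precompSurj_mor₂ (h : HomZero t.obj₁ A) : PrecompSurj A t.mor₂ := fun y =>
  (Triangle.yoneda_exact₂ t ht y (h _)).imp fun _ h => h.symm

lemma precompInj_mor₂ (h : HomZero (t.obj₁⟦(1 : ℤ)⟧) A) : PrecompInj A t.mor₂ := fun x hx => by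
  obtain ⟨y, rfl⟩ := Triangle.yoneda_exact₃ t ht x hx
  rw [h y, comp_zero]

lemma precompInj_mor₁ (h : HomZero t.obj₃ A) : PrecompInj A t.mor₁ := fun x hx => by
  obtain ⟨y, rfl⟩ := Triangle.yoneda_exact₂ t ht x hx
  rw [h y, comp_zero]

lemma precompSurj_mor₁ (h : HomZero t.obj₃ (A⟦(1 : ℤ)⟧)) : PrecompSurj A t.mor₁ := fun y => by
  obtain ⟨x, hx⟩ := Triangle.yoneda_exact₂ _ (rot_of_distTriang _ (rot_of_distTriang _ ht))
    (y⟦(1 : ℤ)⟧') (h _)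
  obtain ⟨x, rfl⟩ : ∃ x' : t.obj₂ ⟶ A, x'⟦(1 : ℤ)⟧' = x :=
    (shiftFunctor D (1 : ℤ)).map_surjective x
  -- Rotating twice replaces `t.mor₁` by the negative of its shift, whence the sign.
  refine ⟨-x, (shiftFunctor D (1 : ℤ)).map_injective ?_⟩
  rw [hx, Functor.map_comp, Functor.map_neg, Preadditive.comp_neg]
  exact (Preadditive.neg_comp _ _).symm

lemma homZero_obj₃ (h₁ : PrecompSurj A t.mor₁) (h₂ : PrecompInj (A⟦(1 : ℤ)⟧) t.mor₁) :
    HomZero t.obj₃ (A⟦(1 : ℤ)⟧) := by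
  intro x
  have hx : t.mor₂ ≫ x = 0 := h₂ _ (by
    rw [← Category.assoc, comp_distTriang_mor_zero₁₂ _ ht, zero_comp])
  obtain ⟨y, rfl⟩ := Triangle.yoneda_exact₃ t ht x hx
  obtain ⟨y, rfl⟩ := (shiftFunctor D (1 : ℤ)).map_surjective y
  obtain ⟨z, rfl⟩ := h₁ y
  rw [Functor.map_comp, ← Category.assoc, comp_distTriang_mor_zero₃₁ _ ht, zero_comp]

end

/-- Orthogonality and decompositions force maximality: if `Y` is orthogonal to `U`, the map `A ⟶ Y`
of its decomposition triangle vanishes, so the identity of `Y` factors through `B` and `Y` is a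
retract of `B`. The other side is dual. -/
lemma IsTorsionPair.of_homZero {U V : ObjectProperty D}
    (hU : ∀ X Y : D, Retract X Y → U Y → U X) (hV : ∀ X Y : D, Retract X Y → V Y → V X)
    (hUV : ∀ X Y : D, U X → V Y → HomZero X Y)
    (h : ∀ X : D, ∃ (A B : D) (f : A ⟶ X) (g : X ⟶ B) (h : B ⟶ A⟦(1 : ℤ)⟧),
      U A ∧ V B ∧ Triangle.mk f g h ∈ distTriang D) : IsTorsionPair U V where
  left_retracts := ⟨fun r hY => hU _ _ r hY⟩
  right_retracts := ⟨fun r hY => hV _ _ r hY⟩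
  right_eq := by
    refine le_antisymm (fun Y hY => ?_) (fun Y hY X f hX => hUV X Y hX hY f)
    obtain ⟨A, B, f, g, k, hA, hB, ht⟩ := h Y
    obtain ⟨r, hr⟩ := Triangle.yoneda_exact₂ _ ht (𝟙 Y)
      ((Category.comp_id f).trans (hY f hA))
    exact hV _ _ ⟨g, r, hr.symm⟩ hB
  left_eq := by
    refine le_antisymm (fun Y hY => ?_) (fun X hX Y f hY => hUV X Y hX hY f)
    obtain ⟨A, B, f, g, k, hA, hB, ht⟩ := h Y
    obtain ⟨r, hr⟩ := Triangle.coyoneda_exact₂ _ ht (𝟙 Y)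
      ((Category.id_comp g).trans (hY g hB))
    exact hU _ _ ⟨r, f, hr.symm⟩ hA
  exists_triangle := h

open scoped ZeroObject in
/-- Silting criterion: `T` generates, and every morphism to an object of `T^{⊥_{≤0}}` factors
through a suitable approximation by an object of `T^{⊥_{≤0}}`. -/
theorem isSilting_of_exists (T : D)
    (hT : ∀ X : D, (∀ i : ℤ, HomZero (T⟦i⟧) X) → IsZero X)
    (H : ∀ (X V : D) (g : X ⟶ V), (∀ i : ℤ, 0 ≤ i → HomZero (T⟦i⟧) V) →
      ∃ (B : D) (f : X ⟶ B) (g' : B ⟶ V), f ≫ g' = g ∧ (∀ i : ℤ, 0 ≤ i → HomZero (T⟦i⟧) B) ∧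
        ∀ i : ℤ, i ≤ 0 → PostcompSurj (T⟦i⟧) f ∧ PostcompInj (T⟦i - 1⟧) f) :
    IsSilting T := by
  have hU (X : D) : rightPerp (ObjectProperty.singleton T) (Set.Ioi 0) X ↔
      ∀ i : ℤ, i < 0 → HomZero (T⟦i⟧) X := by
    simp [rightPerp_singleton_iff]
  have hV (X : D) : rightPerp (ObjectProperty.singleton T) (Set.Iic 0) X ↔
      ∀ i : ℤ, 0 ≤ i → HomZero (T⟦i⟧) X := by
    simp [rightPerp_singleton_iff]
  refine ⟨.of_homZero ?_ ?_ ?_ ?_, ?_⟩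
  · intro X Y r hY
    rw [hU] at hY ⊢
    exact fun i hi => (hY i hi).of_retract_right r
  · intro X Y r hY
    rw [hV] at hY ⊢
    exact fun i hi => (hY i hi).of_retract_right r
  · intro X Y hX hY g
    rw [hU] at hX
    rw [hV] at hY
    obtain ⟨B, f, g', rfl, hB, hf⟩ := H X Y g hY
    -- For `i ≥ 0` maps from `T⟦i⟧` vanish because `B` is in the coaisle; for `i < 0` they lift to
    -- the aisle object `X`, where they vanish. So generation applies to `B`.
    have : IsZero B := hT B fun i => by
      by_cases hi : 0 ≤ i
      · exact hB i hi
      · exact (hX i (by lia)).of_postcompSurj (hf i (by lia)).1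
    rw [this.eq_of_src g' 0, comp_zero]
  · intro X
    -- Only the approximation of `X` is wanted here, so the target is taken to be zero.
    obtain ⟨B, f, -, -, hB, hf⟩ := H X 0 0 (fun _ _ _ => (isZero_zero D).eq_of_tgt _ _)
    obtain ⟨A, a, b, hab⟩ := distinguished_cocone_triangle₁ f
    refine ⟨A, B, a, f, b, ?_, (hV B).2 hB, hab⟩
    rw [hU]
    intro i hi
    refine homZero_obj₁ hab ?_ ?_
    · exact (hf (i + 1) (by lia)).1.of_iso ((shiftFunctorAdd' D i 1 (i + 1) rfl).app T)
    · have := (hf (i + 1) (by lia)).2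
      rwa [add_sub_cancel_right] at this
  · intro X hX
    rw [hU] at hX ⊢
    intro i hi
    exact (homZero_shift_add_left_iff i (i - 1) 1 (by lia)).2 (hX _ (by lia))

open scoped ZeroObject in
/-- Cosilting criterion: `T` cogenerates, and every morphism from an object of `^{⊥_{≤0}}T` factors
through a suitable approximation by an object of `^{⊥_{≤0}}T`. -/
theorem isCosilting_of_exists (T : D)
    (hT : ∀ X : D, (∀ i : ℤ, HomZero X (T⟦i⟧)) → IsZero X)
    (H : ∀ (U X : D) (g : U ⟶ X), (∀ i : ℤ, i ≤ 0 → HomZero U (T⟦i⟧)) →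
      ∃ (B : D) (f : B ⟶ X) (g' : U ⟶ B), g' ≫ f = g ∧ (∀ i : ℤ, i ≤ 0 → HomZero B (T⟦i⟧)) ∧
        ∀ i : ℤ, 0 ≤ i → PrecompSurj (T⟦i⟧) f ∧ PrecompInj (T⟦i + 1⟧) f) :
    IsCosilting T := by
  have hU (X : D) : leftPerp (ObjectProperty.singleton T) (Set.Iic 0) X ↔
      ∀ i : ℤ, i ≤ 0 → HomZero X (T⟦i⟧) := by
    simp [leftPerp_singleton_iff]
  have hV (X : D) : leftPerp (ObjectProperty.singleton T) (Set.Ioi 0) X ↔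
      ∀ i : ℤ, 0 < i → HomZero X (T⟦i⟧) := by
    simp [leftPerp_singleton_iff]
  refine ⟨.of_homZero ?_ ?_ ?_ ?_, ?_⟩
  · intro X Y r hY
    rw [hU] at hY ⊢
    exact fun i hi => (hY i hi).of_retract_left r
  · intro X Y r hY
    rw [hV] at hY ⊢
    exact fun i hi => (hY i hi).of_retract_left r
  · intro X Y hX hY g
    rw [hU] at hX
    rw [hV] at hY
    obtain ⟨B, f, g', rfl, hB, hf⟩ := H X Y g hX
    have : IsZero B := hT B fun i => by
      by_cases hi : i ≤ 0
      · exact hB i hi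
      · exact (hY i (by lia)).of_precompSurj (hf i (by lia)).1
    rw [this.eq_of_tgt g' 0, zero_comp]
  · intro X
    obtain ⟨B, f, -, -, hB, hf⟩ := H 0 X 0 (fun _ _ _ => (isZero_zero D).eq_of_src _ _)
    obtain ⟨A, a, b, hab⟩ := distinguished_cocone_triangle f
    refine ⟨B, A, f, a, b, (hU B).2 hB, ?_, hab⟩
    rw [hV]
    intro i hi
    -- The third vertex is tested against `T⟦j⟧⟦1⟧`, so `i > 0` corresponds to the range `j ≥ 0`
    -- controlled by the approximation.
    obtain ⟨j, rfl⟩ : ∃ j, i = j + 1 := ⟨i - 1, by lia⟩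
    have e := (shiftFunctorAdd' D j 1 (j + 1) rfl).app T
    exact (homZero_obj₃ hab (hf j (by lia)).1 ((hf j (by lia)).2.of_iso e)).of_iso
      (Iso.refl _) e.symm
  · intro X hX
    rw [hU] at hX ⊢
    intro i hi
    exact (homZero_shift_add_right_iff i (i - 1) 1 (by lia)).2 (hX _ (by lia))

/-- An object orthogonal to all shifts of `T` belongs to the aisle and to the coaisle at once, so
its identity is zero. -/
theorem IsSilting.generates {T : D} (hT : IsSilting T) (X : D) :
    rightPerp (ObjectProperty.singleton T) Set.univ X ↔ IsZero X := by
  constructor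
  · intro h
    have h₁ : rightPerp (ObjectProperty.singleton T) (Set.Ioi 0) X :=
      fun C hC i _ => h C hC i trivial
    have h₂ : rightPerp (ObjectProperty.singleton T) (Set.Iic 0) X :=
      fun C hC i _ => h C hC i trivial
    rw [← hT.right_eq] at h₂
    exact HomZero.isZero fun f => h₂ f h₁
  · intro h C _ i _ f
    exact ((shiftFunctor D i).map_isZero h).eq_of_tgt _ _

theorem IsCosilting.cogenerates {T : D} (hT : IsCosilting T) (X : D) :
    leftPerp (ObjectProperty.singleton T) Set.univ X ↔ IsZero X := by
  constructor
  · intro h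
    have h₁ : leftPerp (ObjectProperty.singleton T) (Set.Ioi 0) X :=
      fun C hC i _ => h C hC i trivial
    have h₂ : leftPerp (ObjectProperty.singleton T) (Set.Iic 0) X :=
      fun C hC i _ => h C hC i trivial
    rw [← hT.right_eq] at h₁
    exact HomZero.isZero fun f => h₁ f h₂
  · intro h C _ i _ f
    exact h.eq_of_src _ _

/-- The aisle is a left orthogonal, hence closed under coproducts and retracts, and it contains `T`
since the coaisle condition includes degree zero. -/
theorem IsSilting.addClosure_le {T : D} (hT : IsSilting T) :
    addClosure.{t} (ObjectProperty.singleton T) ≤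
      rightPerp (ObjectProperty.singleton T) (Set.Ioi 0) := by
  rintro X ⟨I, F, c, hF, ⟨hc⟩, ⟨r⟩⟩
  rw [← hT.left_eq]
  intro V f hV
  rw [rightPerp_singleton_iff] at hV
  refine HomZero.of_retract_left (A := V) (Y := c.pt) (fun g => hc.hom_ext ?_) r f
  rintro ⟨i⟩
  obtain rfl := (ObjectProperty.singleton_iff _ _).1 (hF i)
  rw [comp_zero]
  exact ((hV 0 (by simp)).of_iso ((shiftFunctorZero D ℤ).app _) (Iso.refl _)) _

theorem IsCosilting.prodClosure_le {T : D} (hT : IsCosilting T) :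
    prodClosure.{t} (ObjectProperty.singleton T) ≤
      leftPerp (ObjectProperty.singleton T) (Set.Ioi 0) := by
  rintro X ⟨I, F, c, hF, ⟨hc⟩, ⟨r⟩⟩
  rw [← hT.right_eq]
  intro U f hU
  rw [leftPerp_singleton_iff] at hU
  refine HomZero.of_retract_right (A := U) (Y := c.pt) (fun g => hc.hom_ext ?_) r f
  rintro ⟨i⟩
  obtain rfl := (ObjectProperty.singleton_iff _ _).1 (hF i)
  rw [zero_comp]
  exact ((hU 0 (by simp)).of_iso (Iso.refl _) ((shiftFunctorZero D ℤ).app _)) _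

end Triangulated

end Silting

/-! ### K-projective and K-injective complexes; their coproducts and products in the derived
category. -/

namespace Silting

open CochainComplex HomologicalComplex

section Complexes

variable {C : Type u} [Category.{v} C] [Abelian C]

section Homotopy

variable {J : Type*} (K : J → CochainComplex C ℤ)

lemma sigma_X_hom_ext [HasColimitsOfShape (Discrete J) C] {p : ℤ} {A : C}
    {f g : (∐ K).X p ⟶ A} (h : ∀ j, (Sigma.ι K j).f p ≫ f = (Sigma.ι K j).f p ≫ g) : f = g :=
  Cofan.IsColimit.hom_ext (isColimitOfHasCoproductOfPreservesColimit
    (HomologicalComplex.eval C (.up ℤ) p) K) _ _ h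

lemma pi_X_hom_ext [HasLimitsOfShape (Discrete J) C] {p : ℤ} {A : C}
    {f g : A ⟶ (∏ᶜ K).X p} (h : ∀ j, f ≫ (Pi.π K j).f p = g ≫ (Pi.π K j).f p) : f = g :=
  Fan.IsLimit.hom_ext (isLimitOfHasProductOfPreservesLimit
    (HomologicalComplex.eval C (.up ℤ) p) K) _ _ h

/-- Homotopies to zero on the components of a coproduct assemble to a homotopy to zero. -/
lemma nonempty_homotopy_zero_of_sigma [HasColimitsOfShape (Discrete J) C]
    {L : CochainComplex C ℤ} (φ : ∐ K ⟶ L)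
    (h : ∀ j, Nonempty (Homotopy (Sigma.ι K j ≫ φ) 0)) : Nonempty (Homotopy φ 0) := by
  let hc (p : ℤ) := isColimitOfHasCoproductOfPreservesColimit
    (HomologicalComplex.eval C (.up ℤ) p) K
  let s (p q : ℤ) : (∐ K).X p ⟶ L.X q := Cofan.IsColimit.desc (hc p) fun j => (h j).some.hom p q
  have fac (p q : ℤ) (j : J) : (Sigma.ι K j).f p ≫ s p q = (h j).some.hom p q :=
    Cofan.IsColimit.fac (hc p) _ j
  refine ⟨⟨s, fun p q hpq => sigma_X_hom_ext K fun j => ?_,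
    fun p => sigma_X_hom_ext K fun j => ?_⟩⟩
  · rw [fac, (h j).some.zero p q hpq, comp_zero]
  · have e : (h j).some.hom = fun p q => (Sigma.ι K j).f p ≫ s p q := by
      ext p q; exact (fac p q j).symm
    have := (h j).some.comm p
    rw [e, dNext_comp_left, prevD_comp_left] at this
    simpa using this

/-- Homotopies to zero on the components of a product assemble to a homotopy to zero. -/
lemma nonempty_homotopy_zero_of_pi [HasLimitsOfShape (Discrete J) C]
    {L : CochainComplex C ℤ} (φ : L ⟶ ∏ᶜ K)
    (h : ∀ j, Nonempty (Homotopy (φ ≫ Pi.π K j) 0)) : Nonempty (Homotopy φ 0) := by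
  let hc (p : ℤ) := isLimitOfHasProductOfPreservesLimit
    (HomologicalComplex.eval C (.up ℤ) p) K
  let s (p q : ℤ) : L.X p ⟶ (∏ᶜ K).X q := Fan.IsLimit.lift (hc q) fun j => (h j).some.hom p q
  have fac (p q : ℤ) (j : J) : s p q ≫ (Pi.π K j).f q = (h j).some.hom p q :=
    Fan.IsLimit.fac (hc q) _ j
  refine ⟨⟨s, fun p q hpq => pi_X_hom_ext K fun j => ?_, fun p => pi_X_hom_ext K fun j => ?_⟩⟩
  · rw [fac, (h j).some.zero p q hpq, zero_comp]
  · have e : (h j).some.hom = fun p q => s p q ≫ (Pi.π K j).f q := by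
      ext p q; exact (fac p q j).symm
    have := (h j).some.comm p
    rw [e, dNext_comp_right, prevD_comp_right] at this
    simpa using this

end Homotopy

section Bounds

variable {J : Type*} (K : J → CochainComplex C ℤ)

lemma isStrictlyLE_sigma [HasColimitsOfShape (Discrete J) C] (b : ℤ)
    [∀ j, (K j).IsStrictlyLE b] : (∐ K).IsStrictlyLE b := by
  rw [isStrictlyLE_iff]
  intro p hp
  rw [IsZero.iff_id_eq_zero]
  refine sigma_X_hom_ext K fun j => ?_
  exact ((K j).isZero_of_isStrictlyLE b p hp).eq_of_src _ _

lemma isStrictlyGE_pi [HasLimitsOfShape (Discrete J) C] (b : ℤ)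
    [∀ j, (K j).IsStrictlyGE b] : (∏ᶜ K).IsStrictlyGE b := by
  rw [isStrictlyGE_iff]
  intro p hp
  rw [IsZero.iff_id_eq_zero]
  refine pi_X_hom_ext K fun j => ?_
  exact ((K j).isZero_of_isStrictlyGE b p hp).eq_of_tgt _ _

lemma projective_sigma_X {J : Type v} (K : J → CochainComplex C ℤ)
    [HasColimitsOfShape (Discrete J) C] (p : ℤ)
    [∀ j, Projective ((K j).X p)] : Projective ((∐ K).X p) :=
  Projective.of_iso ((coproductIsCoproduct fun j => (K j).X p).coconePointUniqueUpToIso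
    (isColimitOfHasCoproductOfPreservesColimit (HomologicalComplex.eval C (.up ℤ) p) K))
    (inferInstanceAs (Projective (∐ fun j => (K j).X p)))

lemma injective_pi_X {J : Type v} (K : J → CochainComplex C ℤ)
    [HasLimitsOfShape (Discrete J) C] (p : ℤ)
    [∀ j, Injective ((K j).X p)] : Injective ((∏ᶜ K).X p) :=
  Injective.of_iso ((productIsProduct fun j => (K j).X p).conePointUniqueUpToIso
    (isLimitOfHasProductOfPreservesLimit (HomologicalComplex.eval C (.up ℤ) p) K))
    (inferInstanceAs (Injective (∏ᶜ fun j => (K j).X p)))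

end Bounds

variable [HasDerivedCategory.{w} C]

open DerivedCategory

section KProjective

variable {K L : CochainComplex C ℤ}

lemma Q_map_surjective_of_isKProjective [K.IsKProjective] (f : Q.obj K ⟶ Q.obj L) :
    ∃ φ : K ⟶ L, Q.map φ = f := by
  obtain ⟨g, hg⟩ := (IsKProjective.Qh_map_bijective _ _).surjective
    ((quotientCompQhIso C).hom.app K ≫ f ≫ (quotientCompQhIso C).inv.app L)
  obtain ⟨φ, rfl⟩ := (HomotopyCategory.quotient _ _).map_surjective g
  refine ⟨φ, ?_⟩
  rw [← cancel_epi ((quotientCompQhIso C).hom.app K), ← quotientCompQhIso_hom_naturality, hg]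
  simp

lemma nonempty_homotopy_zero_of_isKProjective [K.IsKProjective] (φ : K ⟶ L)
    (h : Q.map φ = 0) : Nonempty (Homotopy φ 0) := by
  refine ⟨HomotopyCategory.homotopyOfEq _ _
    ((IsKProjective.Qh_map_bijective _ _).injective ?_)⟩
  rw [← cancel_mono ((quotientCompQhIso C).hom.app L), quotientCompQhIso_hom_naturality, h]
  simp

lemma Q_map_surjective_of_isKInjective [L.IsKInjective] (f : Q.obj K ⟶ Q.obj L) :
    ∃ φ : K ⟶ L, Q.map φ = f := by
  obtain ⟨g, hg⟩ := (IsKInjective.Qh_map_bijective _ _).surjective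
    ((quotientCompQhIso C).hom.app K ≫ f ≫ (quotientCompQhIso C).inv.app L)
  obtain ⟨φ, rfl⟩ := (HomotopyCategory.quotient _ _).map_surjective g
  refine ⟨φ, ?_⟩
  rw [← cancel_epi ((quotientCompQhIso C).hom.app K), ← quotientCompQhIso_hom_naturality, hg]
  simp

lemma nonempty_homotopy_zero_of_isKInjective [L.IsKInjective] (φ : K ⟶ L)
    (h : Q.map φ = 0) : Nonempty (Homotopy φ 0) := by
  refine ⟨HomotopyCategory.homotopyOfEq _ _
    ((IsKInjective.Qh_map_bijective _ _).injective ?_)⟩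
  rw [← cancel_mono ((quotientCompQhIso C).hom.app L), quotientCompQhIso_hom_naturality, h]
  simp

lemma homZero_of_isKProjective [K.IsKProjective] (a b : ℤ) (h : b < a) [K.IsStrictlyGE a]
    [L.IsStrictlyLE b] : HomZero (Q.obj K) (Q.obj L) := by
  intro f
  obtain ⟨φ, rfl⟩ := Q_map_surjective_of_isKProjective f
  have : φ = 0 := by
    ext p
    by_cases hp : p < a
    · exact (K.isZero_of_isStrictlyGE a p hp).eq_of_src _ _
    · exact (L.isZero_of_isStrictlyLE b p (by lia)).eq_of_tgt _ _
  rw [this, Functor.map_zero]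

lemma homZero_of_isKInjective [L.IsKInjective] (a b : ℤ) (h : b < a) [K.IsStrictlyGE a]
    [L.IsStrictlyLE b] : HomZero (Q.obj K) (Q.obj L) := by
  intro f
  obtain ⟨φ, rfl⟩ := Q_map_surjective_of_isKInjective f
  have : φ = 0 := by
    ext p
    by_cases hp : p < a
    · exact (K.isZero_of_isStrictlyGE a p hp).eq_of_src _ _
    · exact (L.isZero_of_isStrictlyLE b p (by lia)).eq_of_tgt _ _
  rw [this, Functor.map_zero]

end KProjective

section Coproducts

variable {J : Type*} (K : J → CochainComplex C ℤ)

/-- Morphisms out of a K-projective complex are chain maps up to homotopy. Chain maps glue over a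
coproduct of complexes, which gives existence, and so do null-homotopies, which gives uniqueness.
Exactness of coproducts is not needed. -/
lemma nonempty_isColimit_Q_sigma [HasColimitsOfShape (Discrete J) C]
    [∀ j, (K j).IsKProjective] [(∐ K).IsKProjective] :
    Nonempty (IsColimit (Cofan.mk (Q.obj (∐ K)) fun j => Q.map (Sigma.ι K j))) := by
  have key (Y : DerivedCategory C) (f : ∀ j, Q.obj (K j) ⟶ Y) :
      ∃ g : Q.obj (∐ K) ⟶ Y, ∀ j, Q.map (Sigma.ι K j) ≫ g = f j := by
    obtain ⟨L, ⟨e⟩⟩ : ∃ L, Nonempty (Q.obj L ≅ Y) := ⟨_, ⟨Q.objObjPreimageIso Y⟩⟩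
    choose φ hφ using fun j => Q_map_surjective_of_isKProjective (f j ≫ e.inv)
    refine ⟨Q.map (Sigma.desc φ) ≫ e.hom, fun j => ?_⟩
    rw [← Functor.map_comp_assoc, Sigma.ι_desc, hφ, Category.assoc, e.inv_hom_id,
      Category.comp_id]
  have key' (Y : DerivedCategory C) (g : Q.obj (∐ K) ⟶ Y)
      (hg : ∀ j, Q.map (Sigma.ι K j) ≫ g = 0) : g = 0 := by
    obtain ⟨L, ⟨e⟩⟩ : ∃ L, Nonempty (Q.obj L ≅ Y) := ⟨_, ⟨Q.objObjPreimageIso Y⟩⟩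
    obtain ⟨φ, hφ⟩ := Q_map_surjective_of_isKProjective (g ≫ e.inv)
    obtain ⟨h⟩ := nonempty_homotopy_zero_of_sigma K φ fun j =>
      nonempty_homotopy_zero_of_isKProjective _ (by
        rw [Functor.map_comp, hφ, ← Category.assoc, hg, zero_comp])
    rw [← cancel_mono e.inv, ← hφ, zero_comp, Q_map_eq_of_homotopy _ h, Functor.map_zero]
  refine ⟨Cofan.IsColimit.mk _ (fun s => (key s.pt s.inj).choose)
    (fun s j => (key s.pt s.inj).choose_spec j) fun s m hm => ?_⟩
  rw [← sub_eq_zero]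
  refine key' _ _ fun j => ?_
  rw [Preadditive.comp_sub, (key s.pt s.inj).choose_spec j, sub_eq_zero]
  exact hm j

lemma nonempty_isLimit_Q_pi [HasLimitsOfShape (Discrete J) C]
    [∀ j, (K j).IsKInjective] [(∏ᶜ K).IsKInjective] :
    Nonempty (IsLimit (Fan.mk (Q.obj (∏ᶜ K)) fun j => Q.map (Pi.π K j))) := by
  have key (Y : DerivedCategory C) (f : ∀ j, Y ⟶ Q.obj (K j)) :
      ∃ g : Y ⟶ Q.obj (∏ᶜ K), ∀ j, g ≫ Q.map (Pi.π K j) = f j := by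
    obtain ⟨L, ⟨e⟩⟩ : ∃ L, Nonempty (Q.obj L ≅ Y) := ⟨_, ⟨Q.objObjPreimageIso Y⟩⟩
    choose φ hφ using fun j => Q_map_surjective_of_isKInjective (e.hom ≫ f j)
    refine ⟨e.inv ≫ Q.map (Pi.lift φ), fun j => ?_⟩
    rw [Category.assoc, ← Functor.map_comp, Pi.lift_π, hφ, e.inv_hom_id_assoc]
  have key' (Y : DerivedCategory C) (g : Y ⟶ Q.obj (∏ᶜ K))
      (hg : ∀ j, g ≫ Q.map (Pi.π K j) = 0) : g = 0 := by
    obtain ⟨L, ⟨e⟩⟩ : ∃ L, Nonempty (Q.obj L ≅ Y) := ⟨_, ⟨Q.objObjPreimageIso Y⟩⟩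
    obtain ⟨φ, hφ⟩ := Q_map_surjective_of_isKInjective (e.hom ≫ g)
    obtain ⟨h⟩ := nonempty_homotopy_zero_of_pi K φ fun j =>
      nonempty_homotopy_zero_of_isKInjective _ (by
        rw [Functor.map_comp, hφ, Category.assoc, hg, comp_zero])
    rw [← cancel_epi e.hom, ← hφ, comp_zero, Q_map_eq_of_homotopy _ h, Functor.map_zero]
  refine ⟨Fan.IsLimit.mk _ (fun s => (key s.pt s.proj).choose)
    (fun s j => (key s.pt s.proj).choose_spec j) fun s m hm => ?_⟩
  rw [← sub_eq_zero]
  refine key' _ _ fun j => ?_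
  rw [Preadditive.sub_comp, (key s.pt s.proj).choose_spec j, sub_eq_zero]
  exact hm j

end Coproducts

end Complexes

end Silting

/-! ### The silting case: the tower of cones and its colimit. -/

namespace Silting

open CochainComplex HomologicalComplex DerivedCategory

variable {C : Type u} [Category.{v} C] [Abelian C] [HasDerivedCategory.{w} C]

section Silting

/-- The properties of a step `f : B ⟶ B'` killing the morphisms from `K⟦n⟧` to `B`. -/
structure IsSiltingStep (K : CochainComplex C ℤ) (b n : ℤ) {B B' : CochainComplex C ℤ}
    (f : B ⟶ B') : Prop where
  mono : Mono f
  isIso_f : ∀ k, b - n ≤ k → IsIso (f.f k)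
  homZero : HomZero ((Q.obj K)⟦n⟧) (Q.obj B')
  homZero_of_lt : ∀ j < n, HomZero ((Q.obj K)⟦j⟧) (Q.obj B) → HomZero ((Q.obj K)⟦j⟧) (Q.obj B')
  surj : ∀ j ≤ n, PostcompSurj ((Q.obj K)⟦j⟧) (Q.map f)
  inj : ∀ j < n, PostcompInj ((Q.obj K)⟦j⟧) (Q.map f)
  exists_fac : ∀ (V : CochainComplex C ℤ) (g : B ⟶ V),
    HomZero ((Q.obj K)⟦n⟧) (Q.obj V) → ∃ g' : B' ⟶ V, f ≫ g' = g

variable (K : CochainComplex C ℤ) (a b : ℤ)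

section

variable [K.IsKProjective] {J : Type v} [HasColimitsOfShape (Discrete J) C]
  [(∐ fun _ : J => K).IsKProjective]

-- All properties come from the triangle `∐ K⟦n⟧ → B → cone φ`. Vanishing of `Hom(K⟦j⟧, ∐ K⟦n⟧)` for
-- `j < n` gives injectivity for `j < n` and, after one shift, surjectivity for `j ≤ n`.
include b in
lemma isSiltingStep_inr [K.IsStrictlyLE b] (n : ℤ)
    (hK : ∀ j < (0 : ℤ), HomZero ((Q.obj K)⟦j⟧) (Q.obj (∐ fun _ : J => K)))
    {B : CochainComplex C ℤ} (φ : (∐ fun _ : J => K)⟦n⟧ ⟶ B)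
    (hφ : ∀ x : K⟦n⟧ ⟶ B, ∃ j : J, (Sigma.ι (fun _ : J => K) j)⟦n⟧' ≫ φ = x) :
    IsSiltingStep K b n (mappingCone.inr φ) := by
  have hF (j : ℤ) (hj : j < n) :
      HomZero ((Q.obj K)⟦j⟧) (Q.obj ((∐ fun _ : J => K)⟦n⟧)) :=
    ((homZero_shift_add_left_iff j (j - n) n (by lia)).2 (hK _ (by lia))).of_iso (Iso.refl _)
      ((Q.commShiftIso n).symm.app _)
  have hF' (j : ℤ) (hj : j ≤ n) :
      HomZero ((Q.obj K)⟦j⟧) ((Q.obj ((∐ fun _ : J => K)⟦n⟧))⟦(1 : ℤ)⟧) :=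
    (homZero_shift_add_left_iff j (j - 1) 1 (by lia)).2 (hF _ (by lia))
  have ht := mappingCone_triangle_distinguished φ
  have hsurj (j : ℤ) (hj : j ≤ n) :
      PostcompSurj ((Q.obj K)⟦j⟧) (Q.map (mappingCone.inr φ)) :=
    postcompSurj_mor₂ ht (hF' j hj)
  have hmono (k : ℤ) : (mappingCone.inr φ).f k ≫ (mappingCone.snd φ).v k k (add_zero k) = 𝟙 _ :=
    mappingCone.inr_f_snd_v _ _
  refine ⟨?_, fun k hk => ?_, fun x => ?_, fun j hj h => h.of_postcompSurj (hsurj j hj.le),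
    hsurj, fun j hj => postcompInj_mor₂ ht (hF j hj), fun V g hV => ?_⟩
  · exact mono_of_mono_f _ fun k => mono_of_mono_fac (hmono k)
  · refine ⟨_, hmono k, (mappingCone.ext_from_iff _ _ _ rfl _ _).2 ⟨?_, ?_⟩⟩
    · have := isStrictlyLE_sigma (fun _ : J => K) b
      -- In degree `k` the cone adds the degree `k + 1 + n` part of the coproduct, which is zero as
      -- soon as `k ≥ b - n`.
      exact ((∐ fun _ : J => K).isZero_of_isStrictlyLE b (k + 1 + n) (by lia)).eq_of_src _ _
    · simp
  -- A map `K⟦n⟧ ⟶ cone φ` lifts to `B`, is represented by a chain map, and so factors through `φ`,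
  -- which becomes zero in the cone.
  · obtain ⟨y, rfl⟩ := hsurj n le_rfl x
    obtain ⟨z, hz⟩ := Q_map_surjective_of_isKProjective ((Q.commShiftIso n).hom.app K ≫ y)
    obtain ⟨j, rfl⟩ := hφ z
    rw [← cancel_epi ((Q.commShiftIso n).hom.app K), ← Category.assoc, ← hz, Functor.map_comp,
      Category.assoc, comp_zero]
    have h₀ : Q.map φ ≫ Q.map (mappingCone.inr φ) = 0 := comp_distTriang_mor_zero₁₂ _ ht
    rw [h₀, comp_zero]
  · have hF : HomZero (Q.obj ((∐ fun _ : J => K)⟦n⟧)) (Q.obj V) := by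
      refine HomZero.of_iso (A := (Q.obj (∐ fun _ : J => K))⟦n⟧) ?_
        ((Q.commShiftIso n).symm.app _) (Iso.refl _)
      rw [homZero_shift_left_iff n (-n) (by lia)] at hV ⊢
      obtain ⟨hc⟩ := nonempty_isColimit_Q_sigma fun _ : J => K
      intro x
      refine Cofan.IsColimit.hom_ext hc _ _ fun j => ?_
      rw [comp_zero]
      exact hV _
    -- A null-homotopy of `φ ≫ g` is exactly an extension of `g` to the cone. The factorization is
    -- an equality of chain maps, so such extensions glue along the colimit.
    obtain ⟨h⟩ := nonempty_homotopy_zero_of_isKProjective (φ ≫ g) (hF _)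
    obtain ⟨z, hz⟩ := HomComplex.Cochain.equivHomotopy _ _ h
    exact ⟨mappingCone.desc φ z g (by simpa using hz.symm), mappingCone.inr_desc _ _ _ _⟩

end

variable [∀ i, Projective (K.X i)]

omit [HasDerivedCategory.{w} C] in
lemma isKProjective_sigma [K.IsStrictlyLE b] (J : Type v) [HasColimitsOfShape (Discrete J) C] :
    (∐ fun _ : J => K).IsKProjective :=
  have := isStrictlyLE_sigma (fun _ : J => K) b
  have (i : ℤ) := projective_sigma_X (fun _ : J => K) i
  isKProjective_of_projective _ b

lemma exists_isSiltingStep [HasCoproducts.{v} C] [K.IsStrictlyLE b]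
    (hK : ∀ (J : Type v), ∀ j < (0 : ℤ), HomZero ((Q.obj K)⟦j⟧) (Q.obj (∐ fun _ : J => K)))
    (n : ℤ) (B : CochainComplex C ℤ) :
    ∃ (B' : CochainComplex C ℤ) (f : B ⟶ B'), IsSiltingStep K b n f := by
  have := isKProjective_of_projective K b
  have := isKProjective_sigma K b (K⟦n⟧ ⟶ B)
  -- The source of `φ` is the shift of a coproduct rather than a coproduct of shifts, so the maps
  -- `K⟦n⟧ ⟶ B` are first unshifted and then assembled.
  obtain ⟨e⟩ : Nonempty ((B⟦-n⟧)⟦n⟧ ≅ B) := ⟨(shiftEquiv _ n).counitIso.app B⟩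
  choose x hx using fun y : K⟦n⟧ ⟶ B =>
    (CategoryTheory.shiftFunctor (CochainComplex C ℤ) n).map_surjective (X := K) (Y := B⟦-n⟧)
      (y ≫ e.inv)
  refine ⟨_, _, isSiltingStep_inr K b n (hK (K⟦n⟧ ⟶ B)) ((Sigma.desc x)⟦n⟧' ≫ e.hom) fun y =>
    ⟨y, ?_⟩⟩
  rw [← Category.assoc, ← Functor.map_comp, Sigma.ι_desc, hx, Category.assoc, e.inv_hom_id,
    Category.comp_id]

include a in
/-- A monomorphism which is an isomorphism in sufficiently high degrees induces a bijection on
morphisms from a shift of a bounded complex of projectives. -/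
lemma bijective_postcomp_of_isIso_f [K.IsStrictlyGE a] [K.IsStrictlyLE b]
    {B B' : CochainComplex C ℤ} (f : B ⟶ B') [Mono f] (d : ℤ)
    (hf : ∀ k, d ≤ k → IsIso (f.f k)) (j : ℤ) (hj : d + j < a) :
    PostcompSurj ((Q.obj K)⟦j⟧) (Q.map f) ∧ PostcompInj ((Q.obj K)⟦j⟧) (Q.map f) := by
  have hS : (ShortComplex.mk f (cokernel.π f) (cokernel.condition f)).ShortExact :=
    { exact := ShortComplex.exact_cokernel f }
  have ht := triangleOfSES_distinguished hS
  have : (cokernel f).IsStrictlyLE (d - 1) := by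
    rw [isStrictlyLE_iff]
    intro k hk
    have := hf k (by lia)
    have h₀ : f.f k ≫ (cokernel.π f).f k = 0 := by
      rw [← comp_f, cokernel.condition, zero_f]
    exact IsZero.of_epi_eq_zero _ ((cancel_epi (f.f k)).1 (h₀.trans comp_zero.symm))
  -- `K⟦i⟧` lives in degrees `≥ a - i` and the cokernel in degrees `≤ d - 1`. Injectivity needs `i =
  -- j + 1`, which is what `d + j < a` allows.
  have hL (i : ℤ) (hi : i ≤ j + 1) : HomZero ((Q.obj K)⟦i⟧) (Q.obj (cokernel f)) := by
    have := isKProjective_of_projective K b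
    have := K.isStrictlyGE_shift a i (a - i) (by lia)
    exact (homZero_of_isKProjective (K := K⟦i⟧) (a - i) (d - 1) (by lia)).of_iso
      ((Q.commShiftIso i).app K) (Iso.refl _)
  exact ⟨postcompSurj_mor₁ ht (hL j (by lia)), postcompInj_mor₁ ht ((hL (j + 1) le_rfl).of_iso
    ((CategoryTheory.shiftFunctorAdd' _ j 1 (j + 1) rfl).app _) (Iso.refl _))⟩

section Tower

variable {K b} {F : ℕ ⥤ CochainComplex C ℤ}
  (hF : ∀ n : ℕ, IsSiltingStep K b n (F.map (homOfLE n.le_succ)))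
include hF

omit [∀ i, Projective (K.X i)] in
lemma siltingTower_mono {n m : ℕ} (h : n ≤ m) : Mono (F.map (homOfLE h)) := by
  induction m, h using Nat.le_induction with
  | base => exact inferInstanceAs (Mono (F.map (𝟙 n)))
  | succ m h ih =>
    have := (hF m).mono
    rw [← homOfLE_comp h m.le_succ, F.map_comp]
    infer_instance

omit [∀ i, Projective (K.X i)] in
lemma siltingTower_isIso_f {n m : ℕ} (h : n ≤ m) (k : ℤ) (hk : b - n ≤ k) :
    IsIso ((F.map (homOfLE h)).f k) := by
  induction m, h using Nat.le_induction with
  | base =>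
    change IsIso ((F.map (𝟙 n)).f k)
    rw [F.map_id]
    infer_instance
  | succ m h ih =>
    have := (hF m).isIso_f k (by lia)
    rw [← homOfLE_comp h m.le_succ, F.map_comp, comp_f]
    infer_instance

omit [∀ i, Projective (K.X i)] in
lemma siltingTower_homZero (m j : ℕ) (h : j < m) :
    HomZero ((Q.obj K)⟦(j : ℤ)⟧) (Q.obj (F.obj m)) := by
  induction m, h using Nat.le_induction with
  | base => exact (hF j).homZero
  | succ m h ih => exact (hF m).homZero_of_lt _ (by lia) ih

omit [∀ i, Projective (K.X i)] in
lemma siltingTower_postcomp (m : ℕ) (j : ℤ) (hj : j ≤ 0) :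
    PostcompSurj ((Q.obj K)⟦j⟧) (Q.map (F.map (homOfLE m.zero_le))) ∧
      PostcompInj ((Q.obj K)⟦j - 1⟧) (Q.map (F.map (homOfLE m.zero_le))) := by
  induction m with
  | zero =>
    have : IsIso (F.map (homOfLE (Nat.zero_le 0))) := inferInstanceAs (IsIso (F.map (𝟙 0)))
    exact ⟨postcompSurj_of_isIso _ _, postcompInj_of_isIso _ _⟩
  | succ m ih =>
    rw [← homOfLE_comp m.zero_le m.le_succ, F.map_comp, Functor.map_comp]
    exact ⟨ih.1.comp ((hF m).surj _ (by lia)), ih.2.comp ((hF m).inj _ (by lia))⟩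

variable {c : Cocone F} (hc : IsColimit c)
include hc

omit [∀ i, Projective (K.X i)] in
lemma siltingTower_exists_desc (V : CochainComplex C ℤ) (g : F.obj 0 ⟶ V)
    (hV : ∀ n : ℕ, HomZero ((Q.obj K)⟦(n : ℤ)⟧) (Q.obj V)) :
    ∃ g' : c.pt ⟶ V, c.ι.app 0 ≫ g' = g := by
  choose e he using fun (n : ℕ) (g : F.obj n ⟶ V) => (hF n).exists_fac V g (hV n)
  let s (n : ℕ) : F.obj n ⟶ V := Nat.rec g e n
  let t : Cocone F := ⟨V, NatTrans.ofSequence (G := (Functor.const ℕ).obj V) s fun n => by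
    simpa using he n (s n)⟩
  exact ⟨hc.desc t, hc.fac t 0⟩

variable [HasColimitsOfShape ℕ C]

omit [∀ i, Projective (K.X i)] in
lemma siltingTower_isIso_ι_f (n : ℕ) (k : ℤ) (hk : b - n ≤ k) : IsIso ((c.ι.app n).f k) := by
  have h : (F ⋙ HomologicalComplex.eval C (.up ℤ) k).IsEventuallyConstantFrom n :=
    fun m f => siltingTower_isIso_f hF (leOfHom f) k hk
  exact h.isIso_ι_of_isColimit
    (isColimitOfPreserves (HomologicalComplex.eval C (.up ℤ) k) hc)

-- In each degree the map into the colimit is a monomorphism into a late stage followed by an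
-- isomorphism.
omit [∀ i, Projective (K.X i)] in
lemma siltingTower_mono_ι (n : ℕ) : Mono (c.ι.app n) := by
  refine mono_of_mono_f _ fun k => ?_
  obtain ⟨m, hm, hk⟩ : ∃ m : ℕ, n ≤ m ∧ b - m ≤ k := ⟨n + (b - k).toNat, by lia, by lia⟩
  have := siltingTower_mono hF hm
  have := siltingTower_isIso_ι_f hF hc m k hk
  rw [← c.w (homOfLE hm), comp_f]
  infer_instance

lemma siltingTower_bijective_postcomp [K.IsStrictlyGE a] [K.IsStrictlyLE b] (j : ℤ) (n : ℕ) :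
    ∃ m : ℕ, n ≤ m ∧ PostcompSurj ((Q.obj K)⟦j⟧) (Q.map (c.ι.app m)) ∧
      PostcompInj ((Q.obj K)⟦j⟧) (Q.map (c.ι.app m)) := by
  obtain ⟨m, hm, h⟩ : ∃ m : ℕ, n ≤ m ∧ b - m + j < a :=
    ⟨n + (b + j - a + 1).toNat, by lia, by lia⟩
  have := siltingTower_mono_ι hF hc m
  exact ⟨m, hm, bijective_postcomp_of_isIso_f K a b _ (b - m)
    (fun k hk => siltingTower_isIso_ι_f hF hc m k hk) j h⟩

end Tower

variable [HasCoproducts.{v} C] [HasColimitsOfShape ℕ C] [K.IsStrictlyGE a] [K.IsStrictlyLE b]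
  (hK : ∀ (J : Type v), ∀ j < (0 : ℤ), HomZero ((Q.obj K)⟦j⟧) (Q.obj (∐ fun _ : J => K)))
include a b hK

/-- Approximation by the colimit of a tower of silting steps killing successively the morphisms
from `K`, `K⟦1⟧`, `K⟦2⟧`, ... -/
lemma exists_silting_approximation (X : CochainComplex C ℤ) :
    ∃ (B : CochainComplex C ℤ) (f : X ⟶ B),
      (∀ j : ℤ, 0 ≤ j → HomZero ((Q.obj K)⟦j⟧) (Q.obj B)) ∧
      (∀ j : ℤ, j ≤ 0 → PostcompSurj ((Q.obj K)⟦j⟧) (Q.map f) ∧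
        PostcompInj ((Q.obj K)⟦j - 1⟧) (Q.map f)) ∧
      ∀ (V : CochainComplex C ℤ) (g : X ⟶ V),
        (∀ j : ℤ, 0 ≤ j → HomZero ((Q.obj K)⟦j⟧) (Q.obj V)) → ∃ g' : B ⟶ V, f ≫ g' = g := by
  choose next f hf using fun n : ℕ => exists_isSiltingStep K b hK n
  let B (n : ℕ) : CochainComplex C ℤ := Nat.rec X next n
  let F : ℕ ⥤ CochainComplex C ℤ := Functor.ofSequence (X := B) fun n => f n (B n)
  have hF (n : ℕ) : IsSiltingStep K b n (F.map (homOfLE n.le_succ)) := by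
    have : F.map (homOfLE n.le_succ) = f n (B n) := Functor.ofSequence_map_homOfLE_succ _ n
    rw [this]
    exact hf n (B n)
  have hc := colimit.isColimit F
  have hbij := siltingTower_bijective_postcomp a hF hc
  have hι (m : ℕ) : F.map (homOfLE m.zero_le) ≫ colimit.ι F m = colimit.ι F 0 := colimit.w F _
  refine ⟨colimit F, colimit.ι F 0, fun j hj => ?_, fun j hj => ⟨?_, ?_⟩, fun V g hV => ?_⟩
  · lift j to ℕ using hj
    -- Step `j` kills maps from `K⟦j⟧`, so they vanish at every stage from `j + 1` on; every such
    -- map to the colimit comes from one of these stages.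
    obtain ⟨m, hm, h, -⟩ := hbij j (j + 1)
    exact (siltingTower_homZero hF m j hm).of_postcompSurj h
  · obtain ⟨m, -, h, -⟩ := hbij j 0
    have h' := (siltingTower_postcomp hF m j hj).1.comp h
    rwa [← Functor.map_comp, colimit.cocone_ι, hι] at h'
  · obtain ⟨m, -, -, h⟩ := hbij (j - 1) 0
    have h' := (siltingTower_postcomp hF m j hj).2.comp h
    rwa [← Functor.map_comp, colimit.cocone_ι, hι] at h'
  · exact siltingTower_exists_desc hF hc V g fun n => hV n (by lia)

lemma isSilting_Q_obj (hgen : ∀ X, (∀ i : ℤ, HomZero ((Q.obj K)⟦i⟧) X) → IsZero X) :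
    IsSilting (Q.obj K) := by
  refine isSilting_of_exists _ hgen fun X V g hV => ?_
  obtain ⟨X', ⟨eX⟩⟩ : ∃ L, Nonempty (Q.obj L ≅ X) := ⟨_, ⟨Q.objObjPreimageIso X⟩⟩
  obtain ⟨V', ⟨eV⟩⟩ : ∃ L, Nonempty (Q.obj L ≅ V) := ⟨_, ⟨Q.objObjPreimageIso V⟩⟩
  -- The tower factors chain maps only, so `g` is written as a roof and the source `Y` of the roof
  -- is approximated instead of `X`.
  obtain ⟨Y, s, hs, g₀, hg⟩ := right_fac (eX.hom ≫ g ≫ eV.inv)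
  obtain ⟨B, f, h₁, h₂, h₃⟩ := exists_silting_approximation K a b hK Y
  obtain ⟨g', rfl⟩ := h₃ V' g₀ fun j hj => (hV j hj).of_iso (Iso.refl _) eV.symm
  refine ⟨Q.obj B, eX.inv ≫ inv (Q.map s) ≫ Q.map f, Q.map g' ≫ eV.hom, ?_, h₁, fun i hi =>
    ⟨(postcompSurj_of_isIso _ _).comp ((postcompSurj_of_isIso _ _).comp (h₂ i hi).1),
      (postcompInj_of_isIso _ _).comp ((postcompInj_of_isIso _ _).comp (h₂ i hi).2)⟩⟩
  rw [← cancel_epi eX.hom, ← cancel_mono eV.inv]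
  simp only [Category.assoc, hg, Iso.hom_inv_id_assoc, Functor.map_comp, Iso.hom_inv_id,
    Category.comp_id]

end Silting

lemma rightPerp_singleton_of_iso {T T' : DerivedCategory C} (e : T ≅ T') (I : Set ℤ) :
    rightPerp (ObjectProperty.singleton T) I = rightPerp (ObjectProperty.singleton T') I := by
  ext X
  simp only [rightPerp_singleton_iff]
  exact ⟨fun h i hi => (h i hi).of_iso ((CategoryTheory.shiftFunctor _ i).mapIso e) (Iso.refl _),
    fun h i hi => (h i hi).of_iso ((CategoryTheory.shiftFunctor _ i).mapIso e.symm) (Iso.refl _)⟩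

theorem isSilting_iff_of_isBoundedProjective [HasCoproducts.{v} C] [HasColimitsOfShape ℕ C]
    {T : DerivedCategory C} (hT : IsBoundedProjective T) :
    IsSilting T ↔ addClosure.{v} (ObjectProperty.singleton T) ≤
        rightPerp (ObjectProperty.singleton T) (Set.Ioi 0) ∧
      ∀ X, rightPerp (ObjectProperty.singleton T) Set.univ X ↔ IsZero X := by
  refine ⟨fun h => ⟨h.addClosure_le, h.generates⟩, fun ⟨h₁, h₂⟩ => ?_⟩
  obtain ⟨K, a, b, _, _, _, ⟨e⟩⟩ := hT
  have hsilt : IsSilting (Q.obj K) := by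
    refine isSilting_Q_obj K a b (fun J => ?_) fun X hX => ?_
    · have := isKProjective_of_projective K b
      have := isKProjective_sigma K b J
      obtain ⟨hc⟩ := nonempty_isColimit_Q_sigma fun _ : J => K
      -- `addClosure` of a singleton asks for coproducts of copies of `T` itself, so the cofan is
      -- transported along `e`.
      have hc' : IsColimit (Cofan.mk (f := fun _ : J => T) (Q.obj (∐ fun _ : J => K))
          fun j => e.hom ≫ Q.map (Sigma.ι (fun _ : J => K) j)) :=
        Cofan.IsColimit.mk _ (fun s => Cofan.IsColimit.desc hc fun j => e.inv ≫ s.inj j)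
          (fun s j => by
            have := Cofan.IsColimit.fac hc (fun j => e.inv ≫ s.inj j) j
            dsimp at this ⊢
            rw [Category.assoc, this, e.hom_inv_id_assoc])
          (fun s m hm => Cofan.IsColimit.hom_ext hc _ _ fun j => by
            have := hm j
            rw [Cofan.IsColimit.fac]
            dsimp at this ⊢
            rw [← this, Category.assoc, e.inv_hom_id_assoc])
      have := h₁ (Q.obj (∐ fun _ : J => K))
        ⟨J, fun _ => T, _, fun _ => by simp, ⟨hc'⟩, ⟨Retract.refl _⟩⟩
      rw [rightPerp_singleton_of_iso e, rightPerp_singleton_iff] at this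
      exact fun j hj => this j (by simpa)
    · rw [← h₂, rightPerp_singleton_of_iso e, rightPerp_singleton_iff]
      exact fun i _ => hX i
  rw [IsSilting] at hsilt ⊢
  rwa [rightPerp_singleton_of_iso e, rightPerp_singleton_of_iso e]

end Silting

/-! ### The cosilting case: the tower of cocones and its limit. -/

namespace Silting

open CochainComplex HomologicalComplex DerivedCategory Opposite

variable {C : Type u} [Category.{v} C] [Abelian C] [HasDerivedCategory.{w} C]

section Cosilting

/-- The properties of a step `f : B' ⟶ B` killing the morphisms from `B` to `K⟦n⟧`. -/
structure IsCosiltingStep (K : CochainComplex C ℤ) (a n : ℤ) {B B' : CochainComplex C ℤ}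
    (f : B' ⟶ B) : Prop where
  epi : Epi f
  isIso_f : ∀ k, k + n ≤ a → IsIso (f.f k)
  homZero : HomZero (Q.obj B') ((Q.obj K)⟦n⟧)
  homZero_of_lt : ∀ j, n < j → HomZero (Q.obj B) ((Q.obj K)⟦j⟧) → HomZero (Q.obj B') ((Q.obj K)⟦j⟧)
  surj : ∀ j, n ≤ j → PrecompSurj ((Q.obj K)⟦j⟧) (Q.map f)
  inj : ∀ j, n < j → PrecompInj ((Q.obj K)⟦j⟧) (Q.map f)
  exists_fac : ∀ (V : CochainComplex C ℤ) (g : V ⟶ B),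
    HomZero (Q.obj V) ((Q.obj K)⟦n⟧) → ∃ g' : V ⟶ B', g' ≫ f = g

variable (K : CochainComplex C ℤ) (a b : ℤ)

section

variable [K.IsKInjective] {J : Type v} [HasLimitsOfShape (Discrete J) C]
  [(∏ᶜ fun _ : J => K).IsKInjective]

-- Dual to the cone step, for the triangle `cocone φ → B → ∏ K⟦n⟧`: vanishing of `Hom(∏ K⟦n⟧, K⟦j⟧)`
-- for `j > n` gives injectivity for `j > n` and surjectivity for `j ≥ n`.
include a in
lemma isCosiltingStep_fst [K.IsStrictlyGE a] (n : ℤ)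
    (hK : ∀ j, (0 : ℤ) < j → HomZero (Q.obj (∏ᶜ fun _ : J => K)) ((Q.obj K)⟦j⟧))
    {B : CochainComplex C ℤ} (φ : B ⟶ (∏ᶜ fun _ : J => K)⟦n⟧)
    (hφ : ∀ x : B ⟶ K⟦n⟧, ∃ j : J, φ ≫ (Pi.π (fun _ : J => K) j)⟦n⟧' = x) :
    IsCosiltingStep K a n (mappingCocone.fst φ) := by
  have hF (j : ℤ) (hj : n < j) :
      HomZero (Q.obj ((∏ᶜ fun _ : J => K)⟦n⟧)) ((Q.obj K)⟦j⟧) :=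
    ((homZero_shift_add_right_iff j (j - n) n (by lia)).2 (hK _ (by lia))).of_iso
      ((Q.commShiftIso n).symm.app _) (Iso.refl _)
  have hF' (j : ℤ) (hj : n ≤ j) :
      HomZero (Q.obj ((∏ᶜ fun _ : J => K)⟦n⟧)) (((Q.obj K)⟦j⟧)⟦(1 : ℤ)⟧) :=
    (hF (j + 1) (by lia)).of_iso (Iso.refl _)
      ((CategoryTheory.shiftFunctorAdd' _ j 1 (j + 1) rfl).app _)
  have ht := mappingCocone_triangle_distinguished φ
  have hsurj (j : ℤ) (hj : n ≤ j) :
      PrecompSurj ((Q.obj K)⟦j⟧) (Q.map (mappingCocone.fst φ)) :=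
    precompSurj_mor₁ ht (hF' j hj)
  have hepi (k : ℤ) : (mappingCocone.inl φ).v k k (add_zero k) ≫ (mappingCocone.fst φ).f k = 𝟙 _ :=
    mappingCocone.inl_v_fst_f _ _
  refine ⟨?_, fun k hk => ?_, fun x => ?_, fun j hj h => h.of_precompSurj (hsurj j hj.le),
    hsurj, fun j hj => precompInj_mor₁ ht (hF j hj), fun V g hV => ?_⟩
  · exact epi_of_epi_f _ fun k => epi_of_epi_fac (hepi k)
  · refine ⟨_, ?_, hepi k⟩
    have := isStrictlyGE_pi (fun _ : J => K) a
    -- In degree `k` the cocone adds the degree `k - 1 + n` part of the product, which is zero as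
    -- soon as `k + n ≤ a`.
    have h₀ : (mappingCocone.snd φ).v k (k + -1) rfl = 0 :=
      ((∏ᶜ fun _ : J => K).isZero_of_isStrictlyGE a (k + -1 + n) (by lia)).eq_of_tgt _ _
    have := mappingCocone.id_X φ k (k + -1) rfl
    rwa [h₀, zero_comp, add_zero] at this
  · obtain ⟨y, rfl⟩ := hsurj n le_rfl x
    obtain ⟨z, hz⟩ := Q_map_surjective_of_isKInjective (y ≫ (Q.commShiftIso n).inv.app K)
    obtain ⟨j, rfl⟩ := hφ z
    rw [← cancel_mono ((Q.commShiftIso n).inv.app K), Category.assoc, ← hz, Functor.map_comp,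
      ← Category.assoc, zero_comp]
    have h₀ : Q.map (mappingCocone.fst φ) ≫ Q.map φ = 0 := comp_distTriang_mor_zero₁₂ _ ht
    rw [h₀, zero_comp]
  · have hF : HomZero (Q.obj V) (Q.obj ((∏ᶜ fun _ : J => K)⟦n⟧)) := by
      refine HomZero.of_iso (X := (Q.obj (∏ᶜ fun _ : J => K))⟦n⟧) ?_
        (Iso.refl _) ((Q.commShiftIso n).symm.app _)
      rw [← homZero_shift_left_iff (-n) n (by lia)] at hV ⊢
      obtain ⟨hc⟩ := nonempty_isLimit_Q_pi fun _ : J => K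
      intro x
      refine Fan.IsLimit.hom_ext hc _ _ fun j => ?_
      rw [zero_comp]
      exact hV _
    obtain ⟨h⟩ := nonempty_homotopy_zero_of_isKInjective (g ≫ φ) (hF _)
    obtain ⟨z, hz⟩ := HomComplex.Cochain.equivHomotopy _ _ h
    -- A lift to the cocone needs a cochain whose differential cancels `g ≫ φ`, so the null-homotopy
    -- enters with a minus sign.
    exact ⟨mappingCocone.lift φ g (-z) (by rw [hz]; simp), mappingCocone.lift_fst _ _ _ _⟩

end

variable [∀ i, Injective (K.X i)]

omit [HasDerivedCategory.{w} C] in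
lemma isKInjective_pi [K.IsStrictlyGE a] (J : Type v) [HasLimitsOfShape (Discrete J) C] :
    (∏ᶜ fun _ : J => K).IsKInjective :=
  have := isStrictlyGE_pi (fun _ : J => K) a
  have (i : ℤ) := injective_pi_X (fun _ : J => K) i
  isKInjective_of_injective _ a

lemma exists_isCosiltingStep [HasProducts.{v} C] [K.IsStrictlyGE a]
    (hK : ∀ (J : Type v), ∀ j, (0 : ℤ) < j → HomZero (Q.obj (∏ᶜ fun _ : J => K)) ((Q.obj K)⟦j⟧))
    (n : ℤ) (B : CochainComplex C ℤ) :
    ∃ (B' : CochainComplex C ℤ) (f : B' ⟶ B), IsCosiltingStep K a n f := by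
  have := isKInjective_of_injective K a
  have := isKInjective_pi K a (B ⟶ K⟦n⟧)
  obtain ⟨e⟩ : Nonempty ((B⟦-n⟧)⟦n⟧ ≅ B) := ⟨(shiftEquiv _ n).counitIso.app B⟩
  choose x hx using fun y : B ⟶ K⟦n⟧ =>
    (CategoryTheory.shiftFunctor (CochainComplex C ℤ) n).map_surjective (X := B⟦-n⟧) (Y := K)
      (e.hom ≫ y)
  refine ⟨_, _, isCosiltingStep_fst K a n (hK (B ⟶ K⟦n⟧)) (e.inv ≫ (Pi.lift x)⟦n⟧') fun y =>
    ⟨y, ?_⟩⟩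
  rw [Category.assoc, ← Functor.map_comp, Pi.lift_π, hx, e.inv_hom_id_assoc]

include b in
/-- An epimorphism which is an isomorphism in sufficiently low degrees induces a bijection on
morphisms to a shift of a bounded complex of injectives. -/
lemma bijective_precomp_of_isIso_f [K.IsStrictlyGE a] [K.IsStrictlyLE b]
    {B B' : CochainComplex C ℤ} (f : B' ⟶ B) [Epi f] (d : ℤ)
    (hf : ∀ k, k ≤ d → IsIso (f.f k)) (j : ℤ) (hj : b < d + j) :
    PrecompSurj ((Q.obj K)⟦j⟧) (Q.map f) ∧ PrecompInj ((Q.obj K)⟦j⟧) (Q.map f) := by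
  have hS : (ShortComplex.mk (kernel.ι f) f (kernel.condition f)).ShortExact :=
    { exact := ShortComplex.exact_kernel f }
  have ht := triangleOfSES_distinguished hS
  have : (kernel f).IsStrictlyGE (d + 1) := by
    rw [isStrictlyGE_iff]
    intro k hk
    have := hf k (by lia)
    have h₀ : (kernel.ι f).f k ≫ f.f k = 0 := by
      rw [← comp_f, kernel.condition, zero_f]
    exact IsZero.of_mono_eq_zero _ ((cancel_mono (f.f k)).1 (h₀.trans zero_comp.symm))
  -- The kernel lives in degrees `≥ d + 1` and `K⟦i⟧` in degrees `≤ b - i`. Injectivity needs `i = j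
  -- - 1`, which is what `b < d + j` allows.
  have hL (i : ℤ) (hi : j - 1 ≤ i) : HomZero (Q.obj (kernel f)) ((Q.obj K)⟦i⟧) := by
    have := isKInjective_of_injective K a
    have := K.isStrictlyLE_shift b i (b - i) (by lia)
    exact (homZero_of_isKInjective (L := K⟦i⟧) (d + 1) (b - i) (by lia)).of_iso
      (Iso.refl _) ((Q.commShiftIso i).app K)
  exact ⟨precompSurj_mor₂ ht (hL j (by lia)),
    precompInj_mor₂ ht ((homZero_shift_add_right_iff j (j - 1) 1 (by lia)).2 (hL (j - 1) le_rfl))⟩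

section Tower

variable {K a} {F : ℕᵒᵖ ⥤ CochainComplex C ℤ}
  (hF : ∀ n : ℕ, IsCosiltingStep K a (-n) (F.map (homOfLE n.le_succ).op))
include hF

omit [∀ i, Injective (K.X i)] in
lemma cosiltingTower_epi {n m : ℕ} (h : n ≤ m) : Epi (F.map (homOfLE h).op) := by
  induction m, h using Nat.le_induction with
  | base => exact inferInstanceAs (Epi (F.map (𝟙 (op n))))
  | succ m h ih =>
    have := (hF m).epi
    rw [← homOfLE_comp h m.le_succ, op_comp, F.map_comp]
    infer_instance

omit [∀ i, Injective (K.X i)] in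
lemma cosiltingTower_isIso_f {n m : ℕ} (h : n ≤ m) (k : ℤ) (hk : k ≤ a + n) :
    IsIso ((F.map (homOfLE h).op).f k) := by
  induction m, h using Nat.le_induction with
  | base =>
    change IsIso ((F.map (𝟙 (op n))).f k)
    rw [F.map_id]
    infer_instance
  | succ m h ih =>
    have := (hF m).isIso_f k (by lia)
    rw [← homOfLE_comp h m.le_succ, op_comp, F.map_comp, comp_f]
    infer_instance

omit [∀ i, Injective (K.X i)] in
lemma cosiltingTower_homZero (m j : ℕ) (h : j < m) :
    HomZero (Q.obj (F.obj (op m))) ((Q.obj K)⟦(-j : ℤ)⟧) := by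
  induction m, h using Nat.le_induction with
  | base => exact (hF j).homZero
  | succ m h ih => exact (hF m).homZero_of_lt _ (by lia) ih

omit [∀ i, Injective (K.X i)] in
lemma cosiltingTower_precomp (m : ℕ) (j : ℤ) (hj : 0 ≤ j) :
    PrecompSurj ((Q.obj K)⟦j⟧) (Q.map (F.map (homOfLE m.zero_le).op)) ∧
      PrecompInj ((Q.obj K)⟦j + 1⟧) (Q.map (F.map (homOfLE m.zero_le).op)) := by
  induction m with
  | zero =>
    have : IsIso (F.map (homOfLE (Nat.zero_le 0)).op) :=
      inferInstanceAs (IsIso (F.map (𝟙 (op 0))))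
    exact ⟨precompSurj_of_isIso _ _, precompInj_of_isIso _ _⟩
  | succ m ih =>
    rw [← homOfLE_comp m.zero_le m.le_succ, op_comp, F.map_comp, Functor.map_comp]
    exact ⟨((hF m).surj _ (by lia)).comp ih.1, ((hF m).inj _ (by lia)).comp ih.2⟩

variable {c : Cone F} (hc : IsLimit c)
include hc

omit [∀ i, Injective (K.X i)] in
lemma cosiltingTower_exists_lift (V : CochainComplex C ℤ) (g : V ⟶ F.obj (op 0))
    (hV : ∀ n : ℕ, HomZero (Q.obj V) ((Q.obj K)⟦(-n : ℤ)⟧)) :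
    ∃ g' : V ⟶ c.pt, g' ≫ c.π.app (op 0) = g := by
  choose e he using fun (n : ℕ) (g : V ⟶ F.obj (op n)) => (hF n).exists_fac V g (hV n)
  let s (n : ℕ) : V ⟶ F.obj (op n) := Nat.rec g e n
  let t : Cone F := ⟨V, NatTrans.ofOpSequence (F := (Functor.const ℕᵒᵖ).obj V) s fun n => by
    simpa using (he n (s n)).symm⟩
  exact ⟨hc.lift t, hc.fac t (op 0)⟩

variable [HasLimitsOfShape ℕᵒᵖ C]

omit [∀ i, Injective (K.X i)] in
lemma cosiltingTower_isIso_π_f (n : ℕ) (k : ℤ) (hk : k ≤ a + n) :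
    IsIso ((c.π.app (op n)).f k) := by
  have h : (F ⋙ HomologicalComplex.eval C (.up ℤ) k).IsEventuallyConstantTo (op n) :=
    fun m f => cosiltingTower_isIso_f hF (leOfHom f.unop) k hk
  exact h.isIso_π_of_isLimit
    (isLimitOfPreserves (HomologicalComplex.eval C (.up ℤ) k) hc)

omit [∀ i, Injective (K.X i)] in
lemma cosiltingTower_epi_π (n : ℕ) : Epi (c.π.app (op n)) := by
  refine epi_of_epi_f _ fun k => ?_
  obtain ⟨m, hm, hk⟩ : ∃ m : ℕ, n ≤ m ∧ k ≤ a + m := ⟨n + (k - a).toNat, by lia, by lia⟩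
  have := cosiltingTower_epi hF hm
  have := cosiltingTower_isIso_π_f hF hc m k hk
  rw [← c.w (homOfLE hm).op, comp_f]
  infer_instance

lemma cosiltingTower_bijective_precomp [K.IsStrictlyGE a] [K.IsStrictlyLE b] (j : ℤ) (n : ℕ) :
    ∃ m : ℕ, n ≤ m ∧ PrecompSurj ((Q.obj K)⟦j⟧) (Q.map (c.π.app (op m))) ∧
      PrecompInj ((Q.obj K)⟦j⟧) (Q.map (c.π.app (op m))) := by
  obtain ⟨m, hm, h⟩ : ∃ m : ℕ, n ≤ m ∧ b < a + m + j :=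
    ⟨n + (b - j - a + 1).toNat, by lia, by lia⟩
  have := cosiltingTower_epi_π hF hc m
  exact ⟨m, hm, bijective_precomp_of_isIso_f K a b _ (a + m)
    (fun k hk => cosiltingTower_isIso_π_f hF hc m k hk) j h⟩

end Tower

variable [HasProducts.{v} C] [HasLimitsOfShape ℕᵒᵖ C] [K.IsStrictlyGE a] [K.IsStrictlyLE b]
  (hK : ∀ (J : Type v), ∀ j, (0 : ℤ) < j → HomZero (Q.obj (∏ᶜ fun _ : J => K)) ((Q.obj K)⟦j⟧))
include a b hK

/-- Approximation by the limit of a tower of cosilting steps killing successively the morphisms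
to `K`, `K⟦-1⟧`, `K⟦-2⟧`, ... -/
lemma exists_cosilting_approximation (X : CochainComplex C ℤ) :
    ∃ (B : CochainComplex C ℤ) (f : B ⟶ X),
      (∀ j : ℤ, j ≤ 0 → HomZero (Q.obj B) ((Q.obj K)⟦j⟧)) ∧
      (∀ j : ℤ, 0 ≤ j → PrecompSurj ((Q.obj K)⟦j⟧) (Q.map f) ∧
        PrecompInj ((Q.obj K)⟦j + 1⟧) (Q.map f)) ∧
      ∀ (V : CochainComplex C ℤ) (g : V ⟶ X),
        (∀ j : ℤ, j ≤ 0 → HomZero (Q.obj V) ((Q.obj K)⟦j⟧)) → ∃ g' : V ⟶ B, g' ≫ f = g := by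
  choose next f hf using fun n : ℕ => exists_isCosiltingStep K a hK (-n)
  let B (n : ℕ) : CochainComplex C ℤ := Nat.rec X next n
  let F : ℕᵒᵖ ⥤ CochainComplex C ℤ := Functor.ofOpSequence (X := B) fun n => f n (B n)
  have hF (n : ℕ) : IsCosiltingStep K a (-n) (F.map (homOfLE n.le_succ).op) := by
    have : F.map (homOfLE n.le_succ).op = f n (B n) := Functor.ofOpSequence_map_homOfLE_succ _ n
    rw [this]
    exact hf n (B n)
  have hc := limit.isLimit F
  have hbij := cosiltingTower_bijective_precomp b hF hc
  have hπ (m : ℕ) : limit.π F (op m) ≫ F.map (homOfLE m.zero_le).op = limit.π F (op 0) :=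
    limit.w F _
  refine ⟨limit F, limit.π F (op 0), fun j hj => ?_, fun j hj => ⟨?_, ?_⟩, fun V g hV => ?_⟩
  · obtain ⟨i, rfl⟩ : ∃ i : ℕ, j = -i := ⟨(-j).toNat, by lia⟩
    obtain ⟨m, hm, h, -⟩ := hbij (-i) (i + 1)
    exact (cosiltingTower_homZero hF m i hm).of_precompSurj h
  · obtain ⟨m, -, h, -⟩ := hbij j 0
    have h' := h.comp (cosiltingTower_precomp hF m j hj).1
    rwa [← Functor.map_comp, limit.cone_π, hπ] at h'
  · obtain ⟨m, -, -, h⟩ := hbij (j + 1) 0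
    have h' := h.comp (cosiltingTower_precomp hF m j hj).2
    rwa [← Functor.map_comp, limit.cone_π, hπ] at h'
  · exact cosiltingTower_exists_lift hF hc V g fun n => hV _ (by lia)

lemma isCosilting_Q_obj (hgen : ∀ X, (∀ i : ℤ, HomZero X ((Q.obj K)⟦i⟧)) → IsZero X) :
    IsCosilting (Q.obj K) := by
  refine isCosilting_of_exists _ hgen fun U X g hU => ?_
  obtain ⟨X', ⟨eX⟩⟩ : ∃ L, Nonempty (Q.obj L ≅ X) := ⟨_, ⟨Q.objObjPreimageIso X⟩⟩
  obtain ⟨U', ⟨eU⟩⟩ : ∃ L, Nonempty (Q.obj L ≅ U) := ⟨_, ⟨Q.objObjPreimageIso U⟩⟩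
  -- The roof now opens the other way: `Y` receives a quasi-isomorphism from the representative of
  -- `X`, and it is `Y` that is approximated.
  obtain ⟨Y, g₀, s, hs, hg⟩ := left_fac (eU.hom ≫ g ≫ eX.inv)
  obtain ⟨B, f, h₁, h₂, h₃⟩ := exists_cosilting_approximation K a b hK Y
  obtain ⟨g', rfl⟩ := h₃ U' g₀ fun j hj => (hU j hj).of_iso eU.symm (Iso.refl _)
  refine ⟨Q.obj B, Q.map f ≫ inv (Q.map s) ≫ eX.hom, eU.inv ≫ Q.map g', ?_, h₁, fun i hi =>
    ⟨(h₂ i hi).1.comp ((precompSurj_of_isIso _ _).comp (precompSurj_of_isIso _ _)),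
      (h₂ i hi).2.comp ((precompInj_of_isIso _ _).comp (precompInj_of_isIso _ _))⟩⟩
  rw [← cancel_epi eU.hom, ← cancel_mono eX.inv]
  simp only [Category.assoc, hg, Iso.hom_inv_id_assoc, Functor.map_comp, Iso.hom_inv_id,
    Category.comp_id]

end Cosilting

lemma leftPerp_singleton_of_iso {T T' : DerivedCategory C} (e : T ≅ T') (I : Set ℤ) :
    leftPerp (ObjectProperty.singleton T) I = leftPerp (ObjectProperty.singleton T') I := by
  ext X
  simp only [leftPerp_singleton_iff]
  exact ⟨fun h i hi => (h i hi).of_iso (Iso.refl _) ((CategoryTheory.shiftFunctor _ i).mapIso e),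
    fun h i hi => (h i hi).of_iso (Iso.refl _) ((CategoryTheory.shiftFunctor _ i).mapIso e.symm)⟩

theorem isCosilting_iff_of_isBoundedInjective [HasProducts.{v} C] [HasLimitsOfShape ℕᵒᵖ C]
    {T : DerivedCategory C} (hT : IsBoundedInjective T) :
    IsCosilting T ↔ prodClosure.{v} (ObjectProperty.singleton T) ≤
        leftPerp (ObjectProperty.singleton T) (Set.Ioi 0) ∧
      ∀ X, leftPerp (ObjectProperty.singleton T) Set.univ X ↔ IsZero X := by
  refine ⟨fun h => ⟨h.prodClosure_le, h.cogenerates⟩, fun ⟨h₁, h₂⟩ => ?_⟩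
  obtain ⟨K, a, b, _, _, _, ⟨e⟩⟩ := hT
  have hcosilt : IsCosilting (Q.obj K) := by
    refine isCosilting_Q_obj K a b (fun J => ?_) fun X hX => ?_
    · have := isKInjective_of_injective K a
      have := isKInjective_pi K a J
      obtain ⟨hc⟩ := nonempty_isLimit_Q_pi fun _ : J => K
      have hc' : IsLimit (Fan.mk (f := fun _ : J => T) (Q.obj (∏ᶜ fun _ : J => K))
          fun j => Q.map (Pi.π (fun _ : J => K) j) ≫ e.inv) :=
        Fan.IsLimit.mk _ (fun s => Fan.IsLimit.lift hc fun j => s.proj j ≫ e.hom)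
          (fun s j => by
            have := Fan.IsLimit.fac hc (fun j => s.proj j ≫ e.hom) j
            dsimp at this ⊢
            rw [reassoc_of% this, e.hom_inv_id, Category.comp_id])
          (fun s m hm => Fan.IsLimit.hom_ext hc _ _ fun j => by
            have := hm j
            rw [Fan.IsLimit.fac]
            dsimp at this ⊢
            rw [← this, Category.assoc, Category.assoc, e.inv_hom_id, Category.comp_id])
      have := h₁ (Q.obj (∏ᶜ fun _ : J => K))
        ⟨J, fun _ => T, _, fun _ => by simp, ⟨hc'⟩, ⟨Retract.refl _⟩⟩
      rw [leftPerp_singleton_of_iso e, leftPerp_singleton_iff] at this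
      exact fun j hj => this j (by simpa)
    · rw [← h₂, leftPerp_singleton_of_iso e, leftPerp_singleton_iff]
      exact fun i _ => hX i
  rw [IsCosilting] at hcosilt ⊢
  rwa [leftPerp_singleton_of_iso e, leftPerp_singleton_of_iso e]

end Silting

/-- Right `R`-modules are the objects of `ModuleCat Rᵐᵒᵖ`; the paired statements are the silting and the cosilting case. -/
theorem mainTheorem4 (R : Type u) [Ring R] [HasDerivedCategory.{w} (ModuleCat.{u} Rᵐᵒᵖ)] :
    (∀ T : DerivedCategory (ModuleCat.{u} Rᵐᵒᵖ), Silting.IsBoundedProjective T →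
      (Silting.IsSilting T ↔
        Silting.addClosure.{u} (ObjectProperty.singleton T) ≤
            Silting.rightPerp (ObjectProperty.singleton T) (Set.Ioi 0) ∧
          ∀ X : DerivedCategory (ModuleCat.{u} Rᵐᵒᵖ),
            Silting.rightPerp (ObjectProperty.singleton T) Set.univ X ↔ IsZero X)) ∧
    (∀ C : DerivedCategory (ModuleCat.{u} Rᵐᵒᵖ), Silting.IsBoundedInjective C →
      (Silting.IsCosilting C ↔
        Silting.prodClosure.{u} (ObjectProperty.singleton C) ≤
            Silting.leftPerp (ObjectProperty.singleton C) (Set.Ioi 0) ∧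
          ∀ X : DerivedCategory (ModuleCat.{u} Rᵐᵒᵖ),
            Silting.leftPerp (ObjectProperty.singleton C) Set.univ X ↔ IsZero X)) := by
  exact ⟨fun _ hT => Silting.isSilting_iff_of_isBoundedProjective hT,
    fun _ hC => Silting.isCosilting_iff_of_isBoundedInjective hC⟩
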